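/- Let $X=\mathbb F_2[x]/(x^2)$, with standard derivation $\partial_x=d/dx$, and let $T(X)=\bigoplus_{n\ge 0}X^{\otimes n}$ be its tensor algebra over $\mathbb F_2$. Let $a,b,c,d$ be the $\mathbb F_2$-linear endomorphisms of $T(X)$ that vanish on $X^{\otimes 0}=\mathbb F_2$ and satisfy, for all $y\in X$ and $w\in T(X)$, \[ a(y\otimes w)=\partial_x y\otimes w,\quad b(y\otimes w)=xy\otimes (a+c)(w),\quad c(y\otimes w)=xy\otimes (a+d)(w),\quad d(y\otimes w)=xy\otimes b(w). \] In other words, they are the natural actions on $T(X)$ of generators with the self-similarity structure $a\mapsto\partial_x$, $b\mapsto x\otimes(a+c)$, $c\mapsto x\otimes(a+d)$, $d\mapsto x\otimes b$. Let ${}_2L_G$ be the restricted Grigorchuk Lie algebra: the restricted Lie subalgebra of $\operatorname{End}_{\mathbb F_2}(T(X))$ generated by $a,b,c,d$, that is, the least subspace that contains $a,b,c,d$ and is closed under the commutator bracket and under the $2$-mapping $u\mapsto u^2$. Theorem. 1. ${}_2L_G$ is nil: for every $u\in{}_2L_G$ there is $n$ such that the $n$-fold iterate $u^{2^n}$ of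 the $2$-mapping vanishes; and also $\operatorname{ad}(u)$ is a nilpotent endomorphism of ${}_2L_G$ for every $u$. 2. Its nillity is unbounded: for every $n$ there is $u\in{}_2L_G$ with $u^{2^n}\neq0$; and also for every $n$ there is $u\in{}_2L_G$ with $\operatorname{ad}(u)^n\neq0$. 3. ${}_2L_G$ is not a nilpotent Lie algebra. -/

import Mathlib

open scoped TensorProduct

namespace SelfSimilarLie

noncomputable section

section Recursion

variable {K X S : Type*} [CommRing K] [CommRing X] [Algebra K X]

/-- The data of a self-similarity structure on generators: `ψ s = (∑ yᵢ ⊗ sᵢ) + δ`, with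
`∑ yᵢ ⊗ sᵢ` in `X ⊗ K⟨S⟩` (`K⟨S⟩` being the free module on the generators) and
`δ` a derivation of `X`. -/
abbrev WreathRecursion (K X S : Type*) [CommRing K] [CommRing X] [Algebra K X] : Type _ :=
  S → (X ⊗[K] (S →₀ K)) × Derivation K X X

/-- Given a value `v s` (to be thought of as `s · w`) for every generator `s`, an element
`y₁ ⊗ s₁ + ⋯` of `X ⊗ K⟨S⟩` and a letter `x₁ : X`, this is
`x₁ y₁ ⊗ (s₁ · w) + ⋯` in the tensor algebra `T(X)`. -/
def tensorPart (x₁ : X) (t : X ⊗[K] (S →₀ K)) (v : S → TensorAlgebra K X) :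
    TensorAlgebra K X :=
  LinearMap.mul' K (TensorAlgebra K X)
    (TensorProduct.map (TensorAlgebra.ι K ∘ₗ LinearMap.mulLeft K x₁)
      (Finsupp.linearCombination K v) t)

/-- From the values `(s · w)` for all generators `s`, together with `w` itself, compute the
values `(s · (x₁ ⊗ w))`, together with `x₁ ⊗ w`, by the formula
`s · (x₁ ⊗ w) = ∑ x₁ yᵢ ⊗ (sᵢ · w) + δ x₁ ⊗ w` where `ψ s = ∑ yᵢ ⊗ sᵢ + δ`. -/
def step (ψ : WreathRecursion K X S) :
    X →ₗ[K] Module.End K ((S → TensorAlgebra K X) × TensorAlgebra K X) :=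
  LinearMap.mk₂ K
    (fun x₁ vw =>
      (fun s => tensorPart x₁ (ψ s).1 vw.1 + TensorAlgebra.ι K ((ψ s).2 x₁) * vw.2,
        TensorAlgebra.ι K x₁ * vw.2))
    (fun x y vw => by
      have h : TensorAlgebra.ι K ∘ₗ LinearMap.mulLeft K (x + y) =
          TensorAlgebra.ι K ∘ₗ LinearMap.mulLeft K x +
            TensorAlgebra.ι K ∘ₗ LinearMap.mulLeft K y := by
        ext z; simp [add_mul]
      refine Prod.ext (funext fun s => ?_) (by simp [add_mul])
      simp only [tensorPart, h, TensorProduct.map_add_left, LinearMap.add_apply, map_add,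
        Prod.fst_add, Pi.add_apply, add_mul]
      abel)
    (fun k x vw => by
      have h : TensorAlgebra.ι K ∘ₗ LinearMap.mulLeft K (k • x) =
          k • (TensorAlgebra.ι K ∘ₗ LinearMap.mulLeft K x) := by
        ext z; simp
      refine Prod.ext (funext fun s => ?_) (by simp)
      simp [tensorPart, h, TensorProduct.map_smul_left])
    (fun x vw vw' => by
      have h : Finsupp.linearCombination K (vw.1 + vw'.1) =
          Finsupp.linearCombination K vw.1 + Finsupp.linearCombination K vw'.1 := by
        ext s; simp
      refine Prod.ext (funext fun s => ?_) (by simp [mul_add])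
      simp only [tensorPart, h, TensorProduct.map_add_right, LinearMap.add_apply, map_add,
        Prod.fst_add, Prod.snd_add, Pi.add_apply, mul_add]
      abel)
    (fun k x vw => by
      have h : Finsupp.linearCombination K (k • vw.1) =
          k • Finsupp.linearCombination K vw.1 := by
        ext s; simp
      refine Prod.ext (funext fun s => ?_) (by simp)
      simp [tensorPart, h, TensorProduct.map_smul_right])

/-- The natural action of the generator `s` on the tensor algebra `T(X)`: the linear
endomorphism with `s · 1 = 0` and `s · (x₁ ⊗ w) = ∑ x₁ yᵢ ⊗ (sᵢ · w) + δ x₁ ⊗ w`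
whenever `ψ s = ∑ yᵢ ⊗ sᵢ + δ`; see `naturalAction_one` and `naturalAction_ι_mul`. -/
def naturalAction (ψ : WreathRecursion K X S) (s : S) : Module.End K (TensorAlgebra K X) :=
  LinearMap.proj s ∘ₗ LinearMap.fst K (S → TensorAlgebra K X) (TensorAlgebra K X) ∘ₗ
    LinearMap.applyₗ ((0, 1) : (S → TensorAlgebra K X) × TensorAlgebra K X) ∘ₗ
      (TensorAlgebra.lift K (step ψ)).toLinearMap

theorem naturalAction_apply (ψ : WreathRecursion K X S) (s : S) (w : TensorAlgebra K X) :
    naturalAction ψ s w = (TensorAlgebra.lift K (step ψ) w (0, 1)).1 s := rfl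

theorem lift_step_snd (ψ : WreathRecursion K X S) (w : TensorAlgebra K X)
    (v : (S → TensorAlgebra K X) × TensorAlgebra K X) :
    (TensorAlgebra.lift K (step ψ) w v).2 = w * v.2 := by
  induction w using TensorAlgebra.induction generalizing v with
  | algebraMap r => simp [Module.algebraMap_end_apply, Algebra.smul_def]
  | ι x => simp [step]
  | mul a b ha hb => simp [ha, hb, mul_assoc]
  | add a b ha hb => simp [ha, hb, add_mul]

theorem naturalAction_one (ψ : WreathRecursion K X S) (s : S) :
    naturalAction ψ s 1 = 0 := by
  simp [naturalAction_apply]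

theorem naturalAction_ι_mul (ψ : WreathRecursion K X S) (s : S) (x₁ : X)
    (w : TensorAlgebra K X) :
    naturalAction ψ s (TensorAlgebra.ι K x₁ * w) =
      tensorPart x₁ (ψ s).1 (fun s' => naturalAction ψ s' w) +
        TensorAlgebra.ι K ((ψ s).2 x₁) * w := by
  have h := lift_step_snd ψ w (0, 1)
  simp only [mul_one] at h
  have h' := congrArg
    (fun y => TensorAlgebra.ι K ((ψ s).2 x₁) * y) h
  simp only [naturalAction_apply, map_mul, Module.End.mul_apply, TensorAlgebra.lift_ι_apply]
  exact congrArg₂ (· + ·) rfl h'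

end Recursion

section Restricted

attribute [local instance 100] LieRing.ofAssociativeRing

variable {K A : Type*} [CommRing K] [Ring A] [Algebra K A]

/-- The restricted Lie subalgebra generated by a subset `s` of an associative algebra `A` of
characteristic `p`: the least Lie subalgebra of `A` (for the commutator bracket) that
contains `s` and is closed under the `p`-mapping `a ↦ a ^ p` of `A`. -/
def restrictedClosure (K : Type*) {A : Type*} [CommRing K] [Ring A] [Algebra K A]
    (p : ℕ) (s : Set A) : LieSubalgebra K A :=
  sInf {L : LieSubalgebra K A | s ⊆ L ∧ ∀ a ∈ L, a ^ p ∈ L}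

theorem subset_restrictedClosure (p : ℕ) (s : Set A) :
    s ⊆ (restrictedClosure K p s : Set A) := by
  intro a ha
  simp only [restrictedClosure, LieSubalgebra.coe_sInf, Set.mem_iInter]
  exact fun L hL => hL.1 ha

theorem pow_mem_restrictedClosure (p : ℕ) (s : Set A) {a : A}
    (ha : a ∈ restrictedClosure K p s) : a ^ p ∈ restrictedClosure K p s := by
  rw [← SetLike.mem_coe] at ha ⊢
  simp only [restrictedClosure, LieSubalgebra.coe_sInf, Set.mem_iInter] at ha ⊢
  exact fun L hL => hL.2 a (ha L hL)

/-- The `p`-mapping of the restricted Lie algebra `restrictedClosure K p s`. -/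
def pMap (K : Type*) {A : Type*} [CommRing K] [Ring A] [Algebra K A] (p : ℕ) (s : Set A)
    (u : restrictedClosure K p s) : restrictedClosure K p s :=
  ⟨(u : A) ^ p, pow_mem_restrictedClosure p s u.2⟩

/-- The restricted self-similar Lie algebra defined by the recursion `ψ` over a ring `K` of
characteristic `p`: the image of the free restricted Lie algebra on `S` under its natural
action on `T(X)`, that is, the restricted Lie algebra of endomorphisms of `T(X)` generated by
the natural actions of the elements of `S`. -/
abbrev restrictedSelfSimilar {K X S : Type*} [CommRing K] [CommRing X] [Algebra K X]
    (p : ℕ) (ψ : WreathRecursion K X S) :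
    LieSubalgebra K (Module.End K (TensorAlgebra K X)) :=
  restrictedClosure K p (Set.range (naturalAction ψ))

end Restricted

section Grigorchuk

attribute [local instance 100] LieRing.ofAssociativeRing

/-- The alphabet `𝔽₂[x]/(x²)`, with `x = DualNumber.eps`. -/
abbrev Alphabet : Type := DualNumber (ZMod 2)

/-- The standard derivation `d/dx` of `𝔽₂[x]/(x²)`, sending `α + β x` to `β`. -/
def partialX : Derivation (ZMod 2) Alphabet Alphabet where
  toFun u := TrivSqZeroExt.inl u.snd
  map_add' u v := by simp
  map_smul' k u := by ext <;> simp
  map_one_eq_zero' := by simp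
  leibniz' u v := by
    ext
    · simp [mul_comm]
    · simp [mul_comm, CharTwo.add_self_eq_zero]

/-- The four generators. -/
inductive Gen : Type
  | a
  | b
  | c
  | d

/-- The recursion `a ↦ ∂ₓ`, `b ↦ x ⊗ (a + c)`, `c ↦ x ⊗ (a + d)`, `d ↦ x ⊗ b`. -/
def grigorchukRecursion : WreathRecursion (ZMod 2) Alphabet Gen
  | .a => (0, partialX)
  | .b => (DualNumber.eps ⊗ₜ (Finsupp.single .a 1 + Finsupp.single .c 1), 0)
  | .c => (DualNumber.eps ⊗ₜ (Finsupp.single .a 1 + Finsupp.single .d 1), 0)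
  | .d => (DualNumber.eps ⊗ₜ Finsupp.single .b 1, 0)

/-- The restricted Grigorchuk Lie algebra over `𝔽₂`. -/
abbrev GrigorchukLie : LieSubalgebra (ZMod 2)
    (Module.End (ZMod 2) (TensorAlgebra (ZMod 2) Alphabet)) :=
  restrictedSelfSimilar 2 grigorchukRecursion

/-- The `2`-mapping `u ↦ u²` of the restricted Grigorchuk Lie algebra. -/
abbrev sqMap : GrigorchukLie → GrigorchukLie :=
  pMap (ZMod 2) 2 (Set.range (naturalAction grigorchukRecursion))

end Grigorchuk

end

end SelfSimilarLie

/-!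
Write `T(X) = 𝔽₂ ⊕ X ⊗ T(X)`, so that `φ ⊗ s` makes sense as an operator on `T(X)`. Modulo a
combination of generators, every element of the algebra is a sum `1 ⊗ p + x ⊗ q`, and in
characteristic two
`(α a + 1 ⊗ p + x ⊗ q)² = 1 ⊗ (p² + α q) + x ⊗ [p, q]`.
As `x² = 0`, the operator `1 ⊗ p + x ⊗ q` is nilpotent as soon as `p` is. If `α = 0` this reduces
nilpotency to the shallower operator `p`; if `α = 1`, squaring reduces it to `p² + q`, whose
combination of generators is the section of the original one, and starting from any combination
the sections reach `α = 0` after finitely many steps.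

Conversely the algebra is branched. With `e = a + c`, one has `[e, b] = 1 ⊗ e` and
`e² = 1 ⊗ (e + b)`, so the restricted algebra generated by `e` and `b` is closed under `1 ⊗ ·`, and
its ideal generated by `1 ⊗ e` is closed under both `1 ⊗ ·` and `x ⊗ ·`. For `u` with `1 ⊗ u` in
this ideal, the fourth power of `e + x ⊗ x ⊗ 1 ⊗ u` is `1 ⊗ 1 ⊗ (1 ⊗ u + x ⊗ e)`, which acts on
`1 ⊗ 1 ⊗ x ⊗ v` as `u` acts on `v`: this step multiplies the nillity of `ad u` by four.
-/

namespace SelfSimilarLie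

noncomputable section

attribute [local instance 100] LieRing.ofAssociativeRing

section RestrictedLie

variable {K A : Type*} [CommRing K] [Ring A] [Algebra K A]

theorem add_sq_of_charTwo [CharP A 2] (u v : A) : (u + v) ^ 2 = u ^ 2 + v ^ 2 + ⁅u, v⁆ := by
  rw [LieRing.of_associative_ring_bracket, CharTwo.sub_eq_add]
  noncomm_ring

theorem ad_pow_expChar_pow (p n : ℕ) [ExpChar (Module.End K A) p] (u : A) :
    LieAlgebra.ad K A u ^ p ^ n = LieAlgebra.ad K A (u ^ p ^ n) := by
  simp only [LieAlgebra.ad_eq_lmul_left_sub_lmul_right, Pi.sub_apply]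
  rw [sub_pow_expChar_pow_of_commute p n (LinearMap.commute_mulLeft_right u u),
    LinearMap.pow_mulLeft, LinearMap.pow_mulRight]

theorem restrictedClosure_le {p : ℕ} {s : Set A} {L : LieSubalgebra K A} (hs : s ⊆ L)
    (hpow : ∀ u ∈ L, u ^ p ∈ L) : restrictedClosure K p s ≤ L :=
  sInf_le ⟨hs, hpow⟩

theorem coe_pMap_iterate (p n : ℕ) (s : Set A) (u : restrictedClosure K p s) :
    (((pMap K p s)^[n] u : restrictedClosure K p s) : A) = (u : A) ^ p ^ n := by
  induction n with
  | zero => simp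
  | succ n ih =>
    rw [Function.iterate_succ_apply', pow_succ, pow_mul, ← ih]
    rfl

theorem ad_pow_eq_zero_of_pMap_iterate_eq_zero {p n : ℕ} [ExpChar (Module.End K A) p]
    {s : Set A} {u : restrictedClosure K p s} (hu : (pMap K p s)^[n] u = 0) :
    LieAlgebra.ad K (restrictedClosure K p s) u ^ p ^ n = 0 := by
  ext v
  rw [LieSubalgebra.coe_ad_pow, ad_pow_expChar_pow, ← coe_pMap_iterate, hu]
  simp

theorem exists_pMap_iterate_eq_zero {p : ℕ} (hp : 1 < p) {s : Set A}
    {u : restrictedClosure K p s} (hu : IsNilpotent (u : A)) : ∃ n, (pMap K p s)^[n] u = 0 := by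
  obtain ⟨n, hn⟩ := hu
  refine ⟨n, Subtype.ext ?_⟩
  rw [coe_pMap_iterate]
  exact pow_eq_zero_of_le (Nat.lt_pow_self hp).le hn

end RestrictedLie

section TensorAlgebra

open TensorAlgebra

variable {K X : Type*} [CommRing K] [AddCommGroup X] [Module K X]

theorem eq_top_of_ι_mul_mem {N : Submodule K (TensorAlgebra K X)} (one : 1 ∈ N)
    (ι_mul : ∀ y, ∀ w ∈ N, ι K y * w ∈ N) : N = ⊤ := by
  suffices h : ∀ w, ∀ t ∈ N, w * t ∈ N from
    eq_top_iff.2 fun w _ => by simpa using h w 1 one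
  intro w
  induction w using TensorAlgebra.induction with
  | algebraMap r => exact fun t ht => by simpa [← Algebra.smul_def] using N.smul_mem r ht
  | ι y => exact ι_mul y
  | mul u v hu hv => exact fun t ht => by simpa [mul_assoc] using hu _ (hv t ht)
  | add u v hu hv => exact fun t ht => by simpa [add_mul] using N.add_mem (hu t ht) (hv t ht)

theorem linearMap_ext_ι_mul {M : Type*} [AddCommGroup M] [Module K M]
    {f g : TensorAlgebra K X →ₗ[K] M} (one : f 1 = g 1)
    (ι_mul : ∀ y w, f (ι K y * w) = g (ι K y * w)) : f = g :=
  LinearMap.eqLocus_eq_top.1 <| eq_top_of_ι_mul_mem one fun y w _ => ι_mul y w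

section liftLeft

variable {M : Type*} [AddCommGroup M] [Module K M] (f : X →ₗ[K] TensorAlgebra K X →ₗ[K] M)

/-- Prepending the letter `y` to a word `w`, while recording the value `f y w`. -/
def liftLeftStep : X →ₗ[K] Module.End K (M × TensorAlgebra K X) :=
  LinearMap.mk₂ K (fun y mw => (f y mw.2, ι K y * mw.2))
    (fun _ _ _ => by simp [add_mul]) (fun _ _ _ => by simp)
    (fun _ _ _ => by simp [mul_add]) (fun _ _ _ => by simp)

theorem liftLeftStep_apply (y : X) (mw : M × TensorAlgebra K X) :
    liftLeftStep f y mw = (f y mw.2, ι K y * mw.2) := rfl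

/-- The linear map on `T(X) = K ⊕ X ⊗ T(X)` that vanishes on `K` and restricts to the bilinear
map `f` on `X ⊗ T(X)`. -/
def liftLeft : TensorAlgebra K X →ₗ[K] M :=
  LinearMap.fst K M (TensorAlgebra K X) ∘ₗ LinearMap.applyₗ (0, 1) ∘ₗ
    (lift K (liftLeftStep f)).toLinearMap

@[simp]
theorem liftLeft_one : liftLeft f 1 = 0 := by
  simp [liftLeft]

theorem lift_liftLeftStep_snd (w : TensorAlgebra K X) (mv : M × TensorAlgebra K X) :
    (lift K (liftLeftStep f) w mv).2 = w * mv.2 := by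
  induction w using TensorAlgebra.induction generalizing mv with
  | algebraMap r => simp [Module.algebraMap_end_apply, Algebra.smul_def]
  | ι y => simp [liftLeftStep_apply]
  | mul u v hu hv => simp [hu, hv, mul_assoc]
  | add u v hu hv => simp [hu, hv, add_mul]

@[simp]
theorem liftLeft_ι_mul (y : X) (w : TensorAlgebra K X) : liftLeft f (ι K y * w) = f y w := by
  simp [liftLeft, liftLeftStep_apply, lift_liftLeftStep_snd]

end liftLeft

/-- The endomorphism `φ ⊗ s` of `T(X) = K ⊕ X ⊗ T(X)`, vanishing on `K`. -/
def tensorAct : Module.End K X →ₗ[K] Module.End K (TensorAlgebra K X) →ₗ[K]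
    Module.End K (TensorAlgebra K X) :=
  LinearMap.mk₂ K (fun φ s => liftLeft ((LinearMap.mul K _).compl₁₂ (ι K ∘ₗ φ) s))
    (fun _ _ _ => linearMap_ext_ι_mul (by simp) (by simp))
    (fun _ _ _ => linearMap_ext_ι_mul (by simp) (by simp))
    (fun _ _ _ => linearMap_ext_ι_mul (by simp) (by simp [mul_add]))
    (fun _ _ _ => linearMap_ext_ι_mul (by simp) (by simp))

variable (φ ψ : Module.End K X) (s t : Module.End K (TensorAlgebra K X))

@[simp]
theorem tensorAct_one_apply : tensorAct φ s 1 = 0 := by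
  simp [tensorAct]

@[simp]
theorem tensorAct_ι_mul (y : X) (w : TensorAlgebra K X) :
    tensorAct φ s (ι K y * w) = ι K (φ y) * s w := by
  simp [tensorAct]

theorem tensorAct_mul_tensorAct :
    tensorAct φ s * tensorAct ψ t = tensorAct (φ * ψ) (s * t) :=
  linearMap_ext_ι_mul (by simp) (by simp)

variable {φ ψ s t}

theorem lie_tensorAct_of_commute (h : Commute φ ψ) :
    ⁅tensorAct φ s, tensorAct ψ t⁆ = tensorAct (φ * ψ) ⁅s, t⁆ := by
  simp only [LieRing.of_associative_ring_bracket, tensorAct_mul_tensorAct, h.eq, map_sub]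

/-- The embedding `s ↦ 1 ⊗ s` of the endomorphisms of `T(X)` as a Lie subalgebra of themselves. -/
def oneTensor : Module.End K (TensorAlgebra K X) →ₗ⁅K⁆ Module.End K (TensorAlgebra K X) :=
  { tensorAct 1 with
    map_lie' := fun {s t} => ((lie_tensorAct_of_commute (Commute.refl 1)).trans (by simp)).symm }

theorem oneTensor_apply : oneTensor s = tensorAct 1 s := rfl

theorem oneTensor_mul : oneTensor s * oneTensor t = oneTensor (s * t) := by
  simp only [oneTensor_apply, tensorAct_mul_tensorAct, one_mul]

theorem tensorAct_ne_zero [IsDomain K] [Module.Free K X] (hφ : φ ≠ 0) (hs : s ≠ 0) :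
    tensorAct φ s ≠ 0 := by
  obtain ⟨y, hy⟩ := DFunLike.ne_iff.1 hφ
  obtain ⟨w, hw⟩ := DFunLike.ne_iff.1 hs
  refine DFunLike.ne_iff.2 ⟨ι K y * w, ?_⟩
  simpa [ι_eq_zero_iff] using And.intro hy hw

theorem eq_zero_of_eq_tensorAct (h : s = tensorAct φ s) : s = 0 :=
  LinearMap.ker_eq_top.1 <| eq_top_of_ι_mul_mem (by rw [LinearMap.mem_ker, h]; simp)
    fun y w hw => by rw [LinearMap.mem_ker, h]; simp [LinearMap.mem_ker.1 hw]

theorem isNilpotent_tensorAct_one_add (hφ : φ * φ = 0) (hs : IsNilpotent s) :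
    IsNilpotent (tensorAct 1 s + tensorAct φ t) := by
  have pow_succ_eq (n : ℕ) : ∃ r, (tensorAct 1 s + tensorAct φ t) ^ (n + 1) =
      tensorAct 1 (s ^ (n + 1)) + tensorAct φ r := by
    induction n with
    | zero => exact ⟨t, by simp⟩
    | succ n ih =>
      obtain ⟨r, hr⟩ := ih
      refine ⟨r * s + s ^ (n + 1) * t, ?_⟩
      rw [pow_succ, hr]
      simp only [mul_add, add_mul, tensorAct_mul_tensorAct, one_mul, mul_one, hφ, map_zero,
        LinearMap.zero_apply, add_zero, map_add, ← pow_succ, add_assoc]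
  obtain ⟨n, hn⟩ := hs
  obtain ⟨r, hr⟩ := pow_succ_eq n
  refine ⟨(n + 1) * 2, ?_⟩
  rw [pow_mul, hr, pow_succ s, hn, zero_mul, map_zero, zero_add, sq, tensorAct_mul_tensorAct, hφ,
    map_zero, LinearMap.zero_apply]

end TensorAlgebra

theorem naturalAction_eq_tensorAct {K X S : Type*} [CommRing K] [CommRing X] [Algebra K X]
    {ψ : WreathRecursion K X S} {s : S} {y : X} {r : S →₀ K} {δ : Derivation K X X}
    (h : ψ s = (y ⊗ₜ r, δ)) :
    naturalAction ψ s = tensorAct (LinearMap.mulLeft K y)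
      (Finsupp.linearCombination K (naturalAction ψ) r) + tensorAct δ 1 := by
  refine linearMap_ext_ι_mul (by simp [naturalAction_one]) fun z w => ?_
  simp [naturalAction_ι_mul, h, tensorPart, mul_comm z, Finsupp.linearCombination_apply,
    LinearMap.finsupp_sum_apply]

section Grigorchuk

/-- The endomorphisms of `T(X)` for `X = 𝔽₂[x]/(x²)`. -/
abbrev Operator : Type := Module.End (ZMod 2) (TensorAlgebra (ZMod 2) Alphabet)

instance : CharP Operator 2 := charP_of_injective_algebraMap' (ZMod 2) 2

instance : CharP (Module.End (ZMod 2) Operator) 2 := charP_of_injective_algebraMap' (ZMod 2) 2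

theorem mulLeft_eps_mul_self : LinearMap.mulLeft (ZMod 2) (DualNumber.eps : Alphabet) *
    LinearMap.mulLeft (ZMod 2) DualNumber.eps = 0 := by
  rw [Module.End.mul_eq_comp, ← LinearMap.mulLeft_mul, DualNumber.eps_mul_eps,
    LinearMap.mulLeft_zero_eq_zero]

/-- The endomorphism `x ⊗ s` of `T(X)`, for `x` the generator of `X = 𝔽₂[x]/(x²)`. -/
def epsTensor : Operator →ₗ[ZMod 2] Operator :=
  tensorAct (LinearMap.mulLeft (ZMod 2) DualNumber.eps)

/-- The action of the generator `a`. -/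
abbrev genA : Operator := naturalAction grigorchukRecursion .a

/-- The action of the generator `b`. -/
abbrev genB : Operator := naturalAction grigorchukRecursion .b

/-- The action of the generator `c`. -/
abbrev genC : Operator := naturalAction grigorchukRecursion .c

/-- The action of the generator `d`. -/
abbrev genD : Operator := naturalAction grigorchukRecursion .d

theorem genA_eq_tensorAct : genA = tensorAct partialX 1 := by
  simpa using naturalAction_eq_tensorAct
    (show grigorchukRecursion .a = (0 ⊗ₜ 0, partialX) by simp [grigorchukRecursion])

theorem genB_eq_epsTensor : genB = epsTensor (genA + genC) := by
  simpa [epsTensor] using naturalAction_eq_tensorAct (ψ := grigorchukRecursion) (s := .b) rfl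

theorem genC_eq_epsTensor : genC = epsTensor (genA + genD) := by
  simpa [epsTensor] using naturalAction_eq_tensorAct (ψ := grigorchukRecursion) (s := .c) rfl

theorem genD_eq_epsTensor : genD = epsTensor genB := by
  simpa [epsTensor] using naturalAction_eq_tensorAct (ψ := grigorchukRecursion) (s := .d) rfl

theorem genD_eq_add : genD = genB + genC := by
  have section_eq : genB + genC + genD = epsTensor (genB + genC + genD) :=
    calc genB + genC + genD
      _ = epsTensor (genA + genC) + epsTensor (genA + genD) + epsTensor genB :=
        congrArg₂ (· + ·) (congrArg₂ (· + ·) genB_eq_epsTensor genC_eq_epsTensor)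
          genD_eq_epsTensor
      _ = epsTensor (genB + genC + genD + (genA + genA)) := by
        simp only [← map_add]
        congr 1
        abel
      _ = epsTensor (genB + genC + genD) := by rw [CharTwo.add_self_eq_zero, add_zero]
  exact (CharTwo.add_eq_zero.1 (eq_zero_of_eq_tensorAct section_eq)).symm

theorem epsTensor_mul_epsTensor (p q : Operator) : epsTensor p * epsTensor q = 0 := by
  simp [epsTensor, tensorAct_mul_tensorAct, mulLeft_eps_mul_self]

theorem genA_mul_genA : genA * genA = 0 := by
  have h : (partialX : Module.End (ZMod 2) Alphabet) * partialX = 0 := by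
    ext y <;> simp [partialX]
  simp [genA_eq_tensorAct, tensorAct_mul_tensorAct, h]

theorem lie_genA_oneTensor (p : Operator) : ⁅genA, oneTensor p⁆ = 0 := by
  rw [genA_eq_tensorAct, oneTensor_apply, lie_tensorAct_of_commute (Commute.one_right _)]
  simp [LieRing.of_associative_ring_bracket]

theorem lie_genA_epsTensor (q : Operator) : ⁅genA, epsTensor q⁆ = oneTensor q := by
  have h : ⁅(partialX : Module.End (ZMod 2) Alphabet),
      LinearMap.mulLeft (ZMod 2) (DualNumber.eps : Alphabet)⁆ = 1 := by
    ext y <;> simp [partialX, LieRing.of_associative_ring_bracket]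
  rw [oneTensor_apply, ← h, genA_eq_tensorAct]
  simp only [LieRing.of_associative_ring_bracket, epsTensor, tensorAct_mul_tensorAct, one_mul,
    mul_one, map_sub, LinearMap.sub_apply]

theorem lie_oneTensor_epsTensor (p q : Operator) :
    ⁅oneTensor p, epsTensor q⁆ = epsTensor ⁅p, q⁆ :=
  lie_tensorAct_of_commute (Commute.one_left _)

theorem lie_epsTensor_oneTensor (p q : Operator) :
    ⁅epsTensor p, oneTensor q⁆ = epsTensor ⁅p, q⁆ :=
  lie_tensorAct_of_commute (Commute.one_right _)

theorem lie_epsTensor_epsTensor (p q : Operator) : ⁅epsTensor p, epsTensor q⁆ = 0 := by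
  simp only [LieRing.of_associative_ring_bracket, epsTensor_mul_epsTensor, sub_self]

theorem lie_genA_add (α α' : ZMod 2) (p p' q q' : Operator) :
    ⁅α • genA + oneTensor p + epsTensor q, α' • genA + oneTensor p' + epsTensor q'⁆ =
      oneTensor (⁅p, p'⁆ + (α • q' - α' • q)) + epsTensor (⁅p, q'⁆ + ⁅q, p'⁆) := by
  have h (q : Operator) : ⁅epsTensor q, genA⁆ = -oneTensor q := by
    rw [← lie_skew, lie_genA_epsTensor]
  have h' (p : Operator) : ⁅oneTensor p, genA⁆ = 0 := by
    rw [← lie_skew, lie_genA_oneTensor, neg_zero]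
  simp only [add_lie, lie_add, smul_lie, LieAlgebra.lie_smul, lie_self, h, h', lie_genA_oneTensor,
    lie_genA_epsTensor, lie_oneTensor_epsTensor, lie_epsTensor_oneTensor, lie_epsTensor_epsTensor,
    map_add, map_sub, map_smul, LieHom.map_lie, smul_zero]
  module

theorem genA_add_sq (α : ZMod 2) (p q : Operator) :
    (α • genA + oneTensor p + epsTensor q) ^ 2 = oneTensor (p ^ 2 + α • q) + epsTensor ⁅p, q⁆ := by
  rw [add_sq_of_charTwo, add_sq_of_charTwo]
  simp only [add_lie, smul_lie, sq, smul_mul_smul_comm, genA_mul_genA,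
    oneTensor_mul, epsTensor_mul_epsTensor, lie_genA_oneTensor, lie_genA_epsTensor,
    lie_oneTensor_epsTensor, map_add, map_smul, smul_zero, add_zero, zero_add]
  abel

/-- The span of the generators, which is spanned by `a`, `b` and `c` as `d = b + c`. -/
def genSpan : Submodule (ZMod 2) Operator := Submodule.span (ZMod 2) {genA, genB, genC}

theorem genA_mem_genSpan : genA ∈ genSpan := Submodule.subset_span (by simp)

theorem genB_mem_genSpan : genB ∈ genSpan := Submodule.subset_span (by simp)

theorem genC_mem_genSpan : genC ∈ genSpan := Submodule.subset_span (by simp)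

theorem genD_mem_genSpan : genD ∈ genSpan :=
  genD_eq_add ▸ add_mem genB_mem_genSpan genC_mem_genSpan

theorem smul_genB_add_smul_genC (β γ : ZMod 2) :
    β • genB + γ • genC = epsTensor (β • (genA + genC) + γ • (genA + genD)) := by
  rw [map_add, map_smul, map_smul, ← genB_eq_epsTensor, ← genC_eq_epsTensor]

theorem smul_add_smul_mem_genSpan (β γ : ZMod 2) :
    β • (genA + genC) + γ • (genA + genD) ∈ genSpan :=
  add_mem (genSpan.smul_mem _ (add_mem genA_mem_genSpan genC_mem_genSpan))
    (genSpan.smul_mem _ (add_mem genA_mem_genSpan genD_mem_genSpan))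

theorem exists_eq_of_mem_genSpan {v : Operator} (hv : v ∈ genSpan) :
    ∃ α : ZMod 2, ∃ q ∈ genSpan, v = α • genA + epsTensor q := by
  obtain ⟨α, β, γ, rfl⟩ := Submodule.mem_span_triple.1 hv
  exact ⟨α, _, smul_add_smul_mem_genSpan β γ, by rw [add_assoc, smul_genB_add_smul_genC]⟩

theorem genSpan_induction {P : Operator → Prop} (eps : ∀ w ∈ genSpan, P (epsTensor w))
    (genA_add : ∀ w ∈ genSpan, P w → P (genA + epsTensor w)) : ∀ v ∈ genSpan, P v := by
  -- Passing to sections terminates: it sends `a + b` to `a + c`, then to `a + d`, then to `b`.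
  have of_genD : P (genA + genD) := by
    rw [genD_eq_epsTensor]
    exact genA_add _ genB_mem_genSpan
      (genB_eq_epsTensor ▸ eps _ (add_mem genA_mem_genSpan genC_mem_genSpan))
  have of_genC : P (genA + genC) := by
    rw [genC_eq_epsTensor]
    exact genA_add _ (add_mem genA_mem_genSpan genD_mem_genSpan) of_genD
  have of_genB : P (genA + genB) := by
    rw [genB_eq_epsTensor]
    exact genA_add _ (add_mem genA_mem_genSpan genC_mem_genSpan) of_genC
  have of_genA : P genA := by
    simpa using genA_add 0 (zero_mem _) (by simpa using eps 0 (zero_mem _))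
  intro v hv
  obtain ⟨α, β, γ, rfl⟩ := Submodule.mem_span_triple.1 hv
  have eq_zero_or_one : ∀ k : ZMod 2, k = 0 ∨ k = 1 := by decide
  rw [add_assoc]
  obtain rfl | rfl := eq_zero_or_one α
  · rw [zero_smul, zero_add, smul_genB_add_smul_genC]
    exact eps _ (smul_add_smul_mem_genSpan β γ)
  · obtain rfl | rfl := eq_zero_or_one β <;> obtain rfl | rfl := eq_zero_or_one γ <;>
      simpa only [zero_smul, one_smul, zero_add, add_zero, ← genD_eq_add]

/-- An increasing filtration containing all commutators and squares of elements of
`GrigorchukLie`: step `n + 1` consists of the operators `1 ⊗ p + x ⊗ q` with `q` in step `n` and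
`p` a combination of generators modulo step `n`. -/
def filtration : ℕ → Submodule (ZMod 2) Operator
  | 0 => ⊥
  | n + 1 => (genSpan ⊔ filtration n).map (oneTensor : Operator →ₗ⁅ZMod 2⁆ Operator).toLinearMap ⊔
      (filtration n).map epsTensor

theorem mem_filtration_succ {n : ℕ} {u : Operator} : u ∈ filtration (n + 1) ↔
    ∃ p ∈ genSpan ⊔ filtration n, ∃ q ∈ filtration n, oneTensor p + epsTensor q = u := by
  simp only [filtration, Submodule.mem_sup (p := Submodule.map _ _), Submodule.mem_map,
    exists_exists_and_eq_and]
  rfl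

theorem filtration_mono : Monotone filtration := by
  refine monotone_nat_of_le_succ fun n => ?_
  dsimp only [filtration]
  induction n with
  | zero => exact bot_le
  | succ n ih =>
    exact sup_le_sup (Submodule.map_mono (sup_le_sup_left ih _)) (Submodule.map_mono ih)

theorem exists_eq_of_mem_genSpan_sup_filtration_succ {n : ℕ} {u : Operator}
    (hu : u ∈ genSpan ⊔ filtration (n + 1)) :
    ∃ α : ZMod 2, ∃ p ∈ genSpan ⊔ filtration n, ∃ q ∈ genSpan ⊔ filtration n,
      u = α • genA + oneTensor p + epsTensor q := by
  obtain ⟨v, hv, f, hf, rfl⟩ := Submodule.mem_sup.1 hu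
  obtain ⟨α, q, hq, rfl⟩ := exists_eq_of_mem_genSpan hv
  obtain ⟨p, hp, q', hq', rfl⟩ := mem_filtration_succ.1 hf
  exact ⟨α, p, hp, q + q', Submodule.add_mem_sup hq hq', by rw [map_add]; abel⟩

theorem lie_mem_filtration_succ {n : ℕ} {u v : Operator} (hu : u ∈ genSpan ⊔ filtration n)
    (hv : v ∈ genSpan ⊔ filtration n) : ⁅u, v⁆ ∈ filtration (n + 1) := by
  induction n generalizing u v with
  | zero =>
    rw [filtration, sup_bot_eq] at hu hv
    obtain ⟨α, q, hq, rfl⟩ := exists_eq_of_mem_genSpan hu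
    obtain ⟨α', q', hq', rfl⟩ := exists_eq_of_mem_genSpan hv
    refine mem_filtration_succ.2 ⟨α • q' - α' • q, Submodule.mem_sup_left
      (sub_mem (genSpan.smul_mem _ hq') (genSpan.smul_mem _ hq)), 0, zero_mem _, ?_⟩
    simpa using (lie_genA_add α α' 0 0 q q').symm
  | succ n ih =>
    obtain ⟨α, p, hp, q, hq, rfl⟩ := exists_eq_of_mem_genSpan_sup_filtration_succ hu
    obtain ⟨α', p', hp', q', hq', rfl⟩ := exists_eq_of_mem_genSpan_sup_filtration_succ hv
    have le : genSpan ⊔ filtration n ≤ genSpan ⊔ filtration (n + 1) :=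
      sup_le_sup_left (filtration_mono n.le_succ) _
    rw [lie_genA_add]
    refine mem_filtration_succ.2 ⟨_, ?_, _, add_mem (ih hp hq') (ih hq hp'), rfl⟩
    exact add_mem (Submodule.mem_sup_right (ih hp hp'))
      (le (sub_mem (Submodule.smul_mem _ _ hq') (Submodule.smul_mem _ _ hq)))

theorem sq_mem_filtration_succ {n : ℕ} {u : Operator} (hu : u ∈ genSpan ⊔ filtration n) :
    u ^ 2 ∈ filtration (n + 1) := by
  induction n generalizing u with
  | zero =>
    rw [filtration, sup_bot_eq] at hu
    obtain ⟨α, q, hq, rfl⟩ := exists_eq_of_mem_genSpan hu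
    refine mem_filtration_succ.2
      ⟨α • q, Submodule.mem_sup_left (genSpan.smul_mem _ hq), 0, zero_mem _, ?_⟩
    simpa using (genA_add_sq α 0 q).symm
  | succ n ih =>
    obtain ⟨α, p, hp, q, hq, rfl⟩ := exists_eq_of_mem_genSpan_sup_filtration_succ hu
    rw [genA_add_sq]
    refine mem_filtration_succ.2 ⟨_, ?_, _, lie_mem_filtration_succ hp hq, rfl⟩
    exact add_mem (Submodule.mem_sup_right (ih hp)) (Submodule.smul_mem _ _
      (sup_le_sup_left (filtration_mono n.le_succ) _ hq))

theorem isNilpotent_add_of_forall_mem {F : Set Operator}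
    (hF : ∀ f ∈ F, ∃ p q, IsNilpotent p ∧ p ^ 2 + q ∈ F ∧ oneTensor p + epsTensor q = f) :
    ∀ v ∈ genSpan, ∀ f ∈ F, IsNilpotent (v + f) := by
  refine genSpan_induction (fun w _ f hf => ?_) (fun w _ ih f hf => ?_)
  · obtain ⟨p, q, hp, -, rfl⟩ := hF f hf
    rw [add_left_comm, ← map_add]
    exact isNilpotent_tensorAct_one_add mulLeft_eps_mul_self hp
  · obtain ⟨p, q, -, hpq, rfl⟩ := hF f hf
    have sq_eq : (genA + epsTensor w + (oneTensor p + epsTensor q)) ^ 2 =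
        oneTensor (w + (p ^ 2 + q)) + epsTensor ⁅p, w + q⁆ := by
      have h := genA_add_sq 1 p (w + q)
      rw [one_smul, one_smul, map_add, add_left_comm (p ^ 2)] at h
      rw [← h]
      congr 1
      abel
    refine IsNilpotent.of_pow (m := 2) ?_
    rw [sq_eq]
    exact isNilpotent_tensorAct_one_add mulLeft_eps_mul_self (ih _ hpq)

theorem isNilpotent_of_mem_genSpan_sup_filtration {n : ℕ} {u : Operator}
    (hu : u ∈ genSpan ⊔ filtration n) : IsNilpotent u := by
  have exists_eq (n : ℕ) : ∀ f ∈ (filtration n : Set Operator), ∃ p q,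
      IsNilpotent p ∧ p ^ 2 + q ∈ (filtration n : Set Operator) ∧
        oneTensor p + epsTensor q = f := by
    induction n with
    | zero =>
      rintro f rfl
      exact ⟨0, 0, by simp [filtration]⟩
    | succ n ih =>
      intro f hf
      obtain ⟨p, hp, q, hq, rfl⟩ := mem_filtration_succ.1 hf
      refine ⟨p, q, ?_, add_mem (sq_mem_filtration_succ hp) (filtration_mono n.le_succ hq), rfl⟩
      obtain ⟨v, hv, g, hg, rfl⟩ := Submodule.mem_sup.1 hp
      exact isNilpotent_add_of_forall_mem ih v hv g hg
  obtain ⟨v, hv, f, hf, rfl⟩ := Submodule.mem_sup.1 hu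
  exact isNilpotent_add_of_forall_mem (exists_eq n) v hv f hf

theorem mem_iSup_genSpan_sup_filtration {u : Operator} :
    u ∈ ⨆ n, genSpan ⊔ filtration n ↔ ∃ n, u ∈ genSpan ⊔ filtration n :=
  Submodule.mem_iSup_of_directed _ (Monotone.directed_le fun _ _ h =>
    sup_le_sup_left (filtration_mono h) _)

/-- The sum of the span of the generators and the union of `filtration`. -/
def filtrationUnion : LieSubalgebra (ZMod 2) Operator :=
  { (⨆ n, genSpan ⊔ filtration n : Submodule (ZMod 2) Operator) with
    lie_mem' := by
      intro u v hu hv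
      obtain ⟨m, hm⟩ := mem_iSup_genSpan_sup_filtration.1 hu
      obtain ⟨n, hn⟩ := mem_iSup_genSpan_sup_filtration.1 hv
      have mono {k : ℕ} (hk : k ≤ max m n) : genSpan ⊔ filtration k ≤ genSpan ⊔ filtration _ :=
        sup_le_sup_left (filtration_mono hk) _
      exact mem_iSup_genSpan_sup_filtration.2 ⟨_, Submodule.mem_sup_right
        (lie_mem_filtration_succ (mono (le_max_left m n) hm) (mono (le_max_right m n) hn))⟩ }

theorem grigorchukLie_le_filtrationUnion : GrigorchukLie ≤ filtrationUnion := by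
  refine restrictedClosure_le ?_ fun u hu => ?_
  · have mem_zero {u : Operator} (hu : u ∈ genSpan) : u ∈ filtrationUnion :=
      mem_iSup_genSpan_sup_filtration.2 ⟨0, Submodule.mem_sup_left hu⟩
    rintro _ ⟨_ | _ | _ | _, rfl⟩
    exacts [mem_zero genA_mem_genSpan, mem_zero genB_mem_genSpan, mem_zero genC_mem_genSpan,
      mem_zero genD_mem_genSpan]
  · obtain ⟨n, hn⟩ := mem_iSup_genSpan_sup_filtration.1 hu
    exact mem_iSup_genSpan_sup_filtration.2
      ⟨n + 1, Submodule.mem_sup_right (sq_mem_filtration_succ hn)⟩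

theorem isNilpotent_of_mem_grigorchukLie {u : Operator} (hu : u ∈ GrigorchukLie) :
    IsNilpotent u := by
  obtain ⟨n, hn⟩ := mem_iSup_genSpan_sup_filtration.1 (grigorchukLie_le_filtrationUnion hu)
  exact isNilpotent_of_mem_genSpan_sup_filtration hn

theorem exists_sqMap_iterate_eq_zero (u : GrigorchukLie) : ∃ n, sqMap^[n] u = 0 :=
  exists_pMap_iterate_eq_zero one_lt_two (isNilpotent_of_mem_grigorchukLie u.2)

theorem isNilpotent_ad_grigorchukLie (u : GrigorchukLie) :
    IsNilpotent (LieAlgebra.ad (ZMod 2) GrigorchukLie u) :=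
  LieSubalgebra.isNilpotent_ad_of_isNilpotent_ad _ <|
    LieAlgebra.ad_nilpotent_of_nilpotent (isNilpotent_of_mem_grigorchukLie u.2)

theorem genA_add_genD_eq : genA + genD = genA + genC + genB := by
  rw [genD_eq_add]
  abel

/-- The restricted Lie algebra generated by `a + c` and `b`, which contains `1 ⊗ s` for every
element `s` of itself. -/
abbrev branchAlgebra : LieSubalgebra (ZMod 2) Operator :=
  restrictedClosure (ZMod 2) 2 {genA + genC, genB}

theorem genA_add_genC_mem_branchAlgebra : genA + genC ∈ branchAlgebra :=
  subset_restrictedClosure _ _ (by simp)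

theorem genB_mem_branchAlgebra : genB ∈ branchAlgebra :=
  subset_restrictedClosure _ _ (by simp)

theorem branchAlgebra_le_grigorchukLie : branchAlgebra ≤ GrigorchukLie := by
  have mem (g : Gen) : naturalAction grigorchukRecursion g ∈ GrigorchukLie :=
    subset_restrictedClosure _ _ (Set.mem_range_self g)
  refine restrictedClosure_le ?_ fun u hu => pow_mem_restrictedClosure _ _ hu
  rintro _ (rfl | rfl)
  exacts [add_mem (mem .a) (mem .c), mem .b]

theorem genA_add_genC_eq : genA + genC = genA + epsTensor (genA + genD) :=
  congrArg (genA + ·) genC_eq_epsTensor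

theorem lie_genA_add_genC_genB : ⁅genA + genC, genB⁆ = oneTensor (genA + genC) := by
  rw [genA_add_genC_eq, genB_eq_epsTensor, add_lie, lie_genA_epsTensor, lie_epsTensor_epsTensor,
    add_zero, ← genA_add_genC_eq]

theorem genA_add_epsTensor_sq (w : Operator) : (genA + epsTensor w) ^ 2 = oneTensor w := by
  simpa using genA_add_sq 1 0 w

theorem genA_add_genC_sq : (genA + genC) ^ 2 = oneTensor (genA + genC + genB) := by
  have h := genA_add_epsTensor_sq (genA + genD)
  rwa [← genA_add_genC_eq, genA_add_genD_eq] at h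

theorem lie_genA_add_genC_oneTensor :
    ⁅genA + genC, oneTensor (genA + genC)⁆ = epsTensor (oneTensor (genA + genC)) := by
  have lie_section : ⁅genA + genD, genA + genC⁆ = oneTensor (genA + genC) := by
    rw [genA_add_genD_eq, add_lie, lie_self, zero_add, ← lie_skew, lie_genA_add_genC_genB,
      CharTwo.neg_eq]
  nth_rw 1 [genA_add_genC_eq]
  rw [add_lie, lie_genA_oneTensor, lie_epsTensor_oneTensor, lie_section, zero_add]

theorem oneTensor_mem_branchAlgebra {u : Operator} (hu : u ∈ branchAlgebra) :
    oneTensor u ∈ branchAlgebra := by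
  suffices h : branchAlgebra ≤ branchAlgebra.comap oneTensor from h hu
  have mem_e : oneTensor (genA + genC) ∈ branchAlgebra :=
    lie_genA_add_genC_genB ▸ branchAlgebra.lie_mem genA_add_genC_mem_branchAlgebra
      genB_mem_branchAlgebra
  refine restrictedClosure_le ?_ fun u hu => ?_
  · rintro _ (rfl | rfl)
    · exact mem_e
    · refine (add_mem_cancel_left mem_e).1 ?_
      rw [LieHom.coe_toLinearMap, ← map_add, ← genA_add_genC_sq]
      exact pow_mem_restrictedClosure _ _ genA_add_genC_mem_branchAlgebra
  · rw [LieSubalgebra.mem_comap, sq, ← oneTensor_mul, ← sq]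
    exact pow_mem_restrictedClosure _ _ hu

/-- The ideal of `branchAlgebra` generated by `1 ⊗ (a + c)`: as for a branch group, it contains
`1 ⊗ s` and `x ⊗ s` for every element `s` of itself. -/
def branchIdeal : LieSubmodule (ZMod 2) branchAlgebra Operator :=
  LieSubmodule.lieSpan (ZMod 2) branchAlgebra {oneTensor (genA + genC)}

theorem oneTensor_genA_add_genC_mem_branchIdeal : oneTensor (genA + genC) ∈ branchIdeal :=
  LieSubmodule.subset_lieSpan rfl

theorem lie_mem_branchIdeal {u v : Operator} (hu : u ∈ branchAlgebra) (hv : v ∈ branchIdeal) :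
    ⁅u, v⁆ ∈ branchIdeal :=
  branchIdeal.lie_mem (x := ⟨u, hu⟩) hv

theorem branchIdeal_induction {N : Submodule (ZMod 2) Operator}
    (base : oneTensor (genA + genC) ∈ N)
    (lie : ∀ u ∈ branchAlgebra, ∀ v ∈ N, ⁅u, v⁆ ∈ N) {v : Operator} (hv : v ∈ branchIdeal) :
    v ∈ N :=
  let N' : LieSubmodule (ZMod 2) branchAlgebra Operator :=
    { N with lie_mem := fun {u : branchAlgebra} {v} hv => lie u u.2 v hv }
  LieSubmodule.lieSpan_le (N := N').2 (Set.singleton_subset_iff.2 base) hv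

theorem mem_branchAlgebra_of_mem_branchIdeal {v : Operator} (hv : v ∈ branchIdeal) :
    v ∈ branchAlgebra :=
  branchIdeal_induction (N := branchAlgebra.toSubmodule)
    (oneTensor_mem_branchAlgebra genA_add_genC_mem_branchAlgebra)
    (fun _ hu _ hv => branchAlgebra.lie_mem hu hv) hv

theorem oneTensor_mem_branchIdeal {v : Operator} (hv : v ∈ branchIdeal) :
    oneTensor v ∈ branchIdeal := by
  refine branchIdeal_induction
    (N := (branchIdeal : Submodule (ZMod 2) Operator).comap oneTensor.toLinearMap) ?_ ?_ hv
  · rw [Submodule.mem_comap, LieHom.coe_toLinearMap, ← lie_genA_add_genC_genB, LieHom.map_lie,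
      ← lie_skew]
    exact neg_mem (lie_mem_branchIdeal (oneTensor_mem_branchAlgebra genB_mem_branchAlgebra)
      oneTensor_genA_add_genC_mem_branchIdeal)
  · intro u hu v hv
    rw [Submodule.mem_comap, LieHom.coe_toLinearMap, LieHom.map_lie]
    exact lie_mem_branchIdeal (oneTensor_mem_branchAlgebra hu) hv

theorem epsTensor_mem_branchIdeal {v : Operator} (hv : v ∈ branchIdeal) :
    epsTensor v ∈ branchIdeal := by
  refine branchIdeal_induction
    (N := (branchIdeal : Submodule (ZMod 2) Operator).comap epsTensor) ?_ ?_ hv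
  · rw [Submodule.mem_comap, ← lie_genA_add_genC_oneTensor]
    exact lie_mem_branchIdeal genA_add_genC_mem_branchAlgebra
      oneTensor_genA_add_genC_mem_branchIdeal
  · intro u hu v hv
    rw [Submodule.mem_comap, ← lie_oneTensor_epsTensor]
    exact lie_mem_branchIdeal (oneTensor_mem_branchAlgebra hu) hv

theorem oneTensor_ne_zero {u : Operator} (hu : u ≠ 0) : oneTensor u ≠ 0 :=
  tensorAct_ne_zero one_ne_zero hu

theorem epsTensor_ne_zero {u : Operator} (hu : u ≠ 0) : epsTensor u ≠ 0 :=
  tensorAct_ne_zero (fun h => by simpa [TrivSqZeroExt.ext_iff] using LinearMap.congr_fun h 1) hu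

theorem genA_add_genC_ne_zero : genA + genC ≠ 0 := by
  intro h
  have lie_eq : ⁅genA + genC, epsTensor 1⁆ = oneTensor 1 := by
    rw [genA_add_genC_eq, add_lie, lie_genA_epsTensor, lie_epsTensor_epsTensor, add_zero]
  rw [h, zero_lie] at lie_eq
  exact oneTensor_ne_zero one_ne_zero lie_eq.symm

theorem genA_add_genC_add_epsTensor_pow_four (u : Operator) :
    (genA + genC + epsTensor (epsTensor (oneTensor u))) ^ 4 =
      oneTensor (oneTensor (oneTensor u + epsTensor (genA + genC))) := by
  have genC_eq : genC = epsTensor (genA + epsTensor (epsTensor (genA + genC))) := by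
    rw [← genB_eq_epsTensor, ← genD_eq_epsTensor, ← genC_eq_epsTensor]
  have section_eq : genA + genC + epsTensor (epsTensor (oneTensor u)) =
      genA + epsTensor (genA + epsTensor (oneTensor u + epsTensor (genA + genC))) :=
    (congrArg (genA + · + _) genC_eq).trans (by simp only [map_add]; abel)
  rw [section_eq, show 4 = 2 * 2 from rfl, pow_mul, genA_add_epsTensor_sq, sq, oneTensor_mul, ← sq,
    genA_add_epsTensor_sq]

theorem lie_genA_add_genC_add_epsTensor_pow_four (u v : Operator) :
    ⁅(genA + genC + epsTensor (epsTensor (oneTensor u))) ^ 4,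
      oneTensor (oneTensor (epsTensor v))⁆ = oneTensor (oneTensor (epsTensor ⁅u, v⁆)) := by
  rw [genA_add_genC_add_epsTensor_pow_four, ← LieHom.map_lie, ← LieHom.map_lie, add_lie,
    lie_oneTensor_epsTensor, lie_epsTensor_epsTensor, add_zero]

theorem exists_ad_pow_four_pow_apply_ne_zero (n : ℕ) :
    ∃ u ∈ branchAlgebra, oneTensor u ∈ branchIdeal ∧
      ∃ v ∈ branchIdeal, (LieAlgebra.ad (ZMod 2) Operator u ^ 4 ^ n) v ≠ 0 := by
  induction n with
  | zero =>
    refine ⟨_, genA_add_genC_mem_branchAlgebra, oneTensor_genA_add_genC_mem_branchIdeal, _,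
      oneTensor_genA_add_genC_mem_branchIdeal, ?_⟩
    rw [pow_zero, pow_one, LieAlgebra.ad_apply, lie_genA_add_genC_oneTensor]
    exact epsTensor_ne_zero (oneTensor_ne_zero genA_add_genC_ne_zero)
  | succ n ih =>
    obtain ⟨u, -, hu, v, hv, huv⟩ := ih
    have mem : epsTensor (epsTensor (oneTensor u)) ∈ branchIdeal :=
      epsTensor_mem_branchIdeal (epsTensor_mem_branchIdeal hu)
    let embed : Operator →ₗ[ZMod 2] Operator :=
      oneTensor.toLinearMap ∘ₗ oneTensor.toLinearMap ∘ₗ epsTensor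
    refine ⟨genA + genC + epsTensor (epsTensor (oneTensor u)),
      add_mem genA_add_genC_mem_branchAlgebra (mem_branchAlgebra_of_mem_branchIdeal mem), ?_,
      oneTensor (oneTensor (epsTensor v)),
      oneTensor_mem_branchIdeal (oneTensor_mem_branchIdeal (epsTensor_mem_branchIdeal hv)), ?_⟩
    · rw [map_add]
      exact add_mem oneTensor_genA_add_genC_mem_branchIdeal (oneTensor_mem_branchIdeal mem)
    · have semiconj : LieAlgebra.ad (ZMod 2) Operator
          ((genA + genC + epsTensor (epsTensor (oneTensor u))) ^ 4) ∘ₗ embed =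
          embed ∘ₗ LieAlgebra.ad (ZMod 2) Operator u :=
        LinearMap.ext fun w => lie_genA_add_genC_add_epsTensor_pow_four u w
      have h := LinearMap.congr_fun (Module.End.commute_pow_left_of_commute semiconj (4 ^ n)) v
      rw [pow_succ', pow_mul, show 4 = 2 ^ 2 from rfl, ad_pow_expChar_pow]
      refine ne_of_eq_of_ne h ?_
      exact oneTensor_ne_zero (oneTensor_ne_zero (epsTensor_ne_zero huv))

theorem exists_ad_pow_ne_zero (n : ℕ) :
    ∃ u : GrigorchukLie, LieAlgebra.ad (ZMod 2) GrigorchukLie u ^ n ≠ 0 := by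
  obtain ⟨u, hu, -, v, hv, huv⟩ := exists_ad_pow_four_pow_apply_ne_zero n
  let u' : GrigorchukLie := ⟨u, branchAlgebra_le_grigorchukLie hu⟩
  let v' : GrigorchukLie :=
    ⟨v, branchAlgebra_le_grigorchukLie (mem_branchAlgebra_of_mem_branchIdeal hv)⟩
  refine ⟨u', fun h => huv ?_⟩
  have ad_pow_eq_zero : LieAlgebra.ad (ZMod 2) GrigorchukLie u' ^ 4 ^ n = 0 :=
    pow_eq_zero_of_le (Nat.lt_pow_self (by norm_num)).le h
  exact (LieSubalgebra.coe_ad_pow _ _ _ u' v' _).symm.trans (by rw [ad_pow_eq_zero]; rfl)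

theorem exists_sqMap_iterate_ne_zero (n : ℕ) : ∃ u : GrigorchukLie, sqMap^[n] u ≠ 0 := by
  obtain ⟨u, hu⟩ := exists_ad_pow_ne_zero (2 ^ n)
  exact ⟨u, fun h => hu (ad_pow_eq_zero_of_pMap_iterate_eq_zero h)⟩

theorem not_isNilpotent_grigorchukLie : ¬ LieRing.IsNilpotent GrigorchukLie := by
  intro h
  obtain ⟨n, hn⟩ := LieAlgebra.nilpotent_ad_of_nilpotent_algebra (ZMod 2) GrigorchukLie
  obtain ⟨u, hu⟩ := exists_ad_pow_ne_zero n
  exact hu (hn u)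

end Grigorchuk

end

end SelfSimilarLie

theorem mainTheorem3 :
    -- nil, for the `2`-mapping and for the adjoint representation
    ((∀ u : SelfSimilarLie.GrigorchukLie, ∃ n : ℕ, SelfSimilarLie.sqMap^[n] u = 0) ∧
      (∀ u : SelfSimilarLie.GrigorchukLie,
        IsNilpotent (LieAlgebra.ad (ZMod 2) SelfSimilarLie.GrigorchukLie u))) ∧
    -- of unbounded nillity, in both senses
    ((∀ n : ℕ, ∃ u : SelfSimilarLie.GrigorchukLie, SelfSimilarLie.sqMap^[n] u ≠ 0) ∧
      (∀ n : ℕ, ∃ u : SelfSimilarLie.GrigorchukLie,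
        LieAlgebra.ad (ZMod 2) SelfSimilarLie.GrigorchukLie u ^ n ≠ 0)) ∧
    -- not nilpotent
    ¬ LieRing.IsNilpotent SelfSimilarLie.GrigorchukLie :=
  open SelfSimilarLie in
  ⟨⟨exists_sqMap_iterate_eq_zero, isNilpotent_ad_grigorchukLie⟩,
    ⟨exists_sqMap_iterate_ne_zero, exists_ad_pow_ne_zero⟩, not_isNilpotent_grigorchukLie⟩
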